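/- Let $J=\begin{pmatrix}0&I_n\\-I_n&0\end{pmatrix}$. By Williamson's theorem, for every real symmetric positive definite $2n\times 2n$ matrix $A$ there is a symplectic matrix $M$ (that is, $M^TJM=J$) such that $M^TAM=\begin{pmatrix}D&0\\0&D\end{pmatrix}$, where $D$ is diagonal with positive diagonal entries $d_1(A)\le\dots\le d_n(A)$; these numbers, uniquely determined by $A$, are the symplectic eigenvalues of $A$. Let $Sp(2n,2n,A)$ be the set of symplectic matrices $M=[u_1,\dots,u_n,v_1,\dots,v_n]$ with $Au_j=d_j(A)Jv_j$ and $Av_j=-d_j(A)Ju_j$ for all $1\le j\le n$. Let $A$ be a real symmetric positive definite $2n\times 2n$ matrix and $1\le m\le n$. Let $i_m$ be the number of $k\le m$ with $d_k(A)=d_m(A)$, let $j_m$ be the number of $k>m$ with $d_k(A)=d_m(A)$, and let $r_m=i_m+j_m$ be the multiplicity of $d_m(A)$. Then $d_m$ is directionally differentiable at $A$: for every real symmetric $2n\times 2n$ matrix $B$ the limit $$d_m'(A;B)=\lim_{t\to0^+}\frac{d_m(A+tB)-d_m(A)}{t}$$ exists in $\mathbb{R}$. Moreover, let $M\in Sp(2n,2n,A)$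 be arbitrary and let $\widetilde M$ be the $2n\times 2r_m$ matrix $[u_{m-i_m+1},\dots,u_{m+j_m},v_{m-i_m+1},\dots,v_{m+j_m}]$ of those columns of $M$ that belong to the symplectic eigenvalue $d_m(A)$. For every real symmetric $2n\times 2n$ matrix $B$ write $$\widetilde B=-\widetilde M^TB\widetilde M=\begin{pmatrix}\widetilde B_{11}&\widetilde B_{12}\\ \widetilde B_{12}^T&\widetilde B_{22}\end{pmatrix}$$ with $r_m\times r_m$ blocks, and let $\widetilde{\widetilde B}$ be the $r_m\times r_m$ Hermitian matrix $\widetilde B_{11}+\widetilde B_{22}+i(\widetilde B_{12}-\widetilde B_{12}^T)$. Then $$d_m'(A;B)=-\tfrac12\,\lambda^{\downarrow}_{i_m}\bigl(\widetilde{\widetilde B}\bigr),$$ where $\lambda^{\downarrow}_{j}(H)$ denotes the $j$-th largest eigenvalue, counted with multiplicity, of a Hermitian matrix $H$. -/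

import Mathlib

open Filter Topology
open scoped Matrix

noncomputable section

namespace SymplecticEigenvalues

/-- The standard symplectic form matrix `J = [[0, I], [-I, 0]]` (the negative of `Matrix.J`). -/
def symplJ (n : ℕ) : Matrix (Fin n ⊕ Fin n) (Fin n ⊕ Fin n) ℝ :=
  Matrix.fromBlocks 0 1 (-1) 0

/-- `M` is a symplectic matrix: `Mᵀ J M = J`. -/
def IsSymplectic {n : ℕ} (M : Matrix (Fin n ⊕ Fin n) (Fin n ⊕ Fin n) ℝ) : Prop :=
  Mᵀ * symplJ n * M = symplJ n

/-- This is membership in Mathlib's symplectic group. -/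
theorem isSymplectic_iff {n : ℕ} (M : Matrix (Fin n ⊕ Fin n) (Fin n ⊕ Fin n) ℝ) :
    IsSymplectic M ↔ M ∈ Matrix.symplecticGroup (Fin n) ℝ := by
  have h : symplJ n = -Matrix.J (Fin n) ℝ := by
    simp [symplJ, Matrix.J, Matrix.fromBlocks_neg]
  rw [IsSymplectic, SymplecticGroup.mem_iff', h]
  simp

/-- `d` lists the diagonal entries, in increasing order, of a Williamson normal form of `A`:
`d₁ ≤ ⋯ ≤ dₙ` are positive and `Mᵀ A M = diag(D, D)`, `D = diag(d₁, …, dₙ)`, for some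
symplectic matrix `M`. -/
def IsWilliamsonDiagonal {n : ℕ} (A : Matrix (Fin n ⊕ Fin n) (Fin n ⊕ Fin n) ℝ)
    (d : Fin n → ℝ) : Prop :=
  Monotone d ∧ (∀ j, 0 < d j) ∧
    ∃ M : Matrix (Fin n ⊕ Fin n) (Fin n ⊕ Fin n) ℝ, IsSymplectic M ∧
      Mᵀ * A * M = Matrix.fromBlocks (Matrix.diagonal d) 0 0 (Matrix.diagonal d)

open Classical in
/-- The symplectic eigenvalues `d₁(A) ≤ ⋯ ≤ dₙ(A)` of a positive definite matrix `A`: the diagonal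
of its Williamson normal form, which exists and is unique for positive definite `A`.
(The value is `0` for matrices that have no Williamson normal form.)
The index `m : Fin n` stands for the 1-based index `m + 1`. -/
def symplEig {n : ℕ} (A : Matrix (Fin n ⊕ Fin n) (Fin n ⊕ Fin n) ℝ) : Fin n → ℝ :=
  if h : ∃ d, IsWilliamsonDiagonal A d then h.choose else 0

/-- `Sp(2n, 2n, A)`: the matrices `M = [u₁, …, uₙ, v₁, …, vₙ]` whose columns form a symplectic
basis (that is, `M` is symplectic) and satisfy `A uⱼ = dⱼ(A) J vⱼ`, `A vⱼ = -dⱼ(A) J uⱼ`. -/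
def symplEigenbases {n : ℕ} (A : Matrix (Fin n ⊕ Fin n) (Fin n ⊕ Fin n) ℝ) :
    Set (Matrix (Fin n ⊕ Fin n) (Fin n ⊕ Fin n) ℝ) :=
  {M | IsSymplectic M ∧ ∀ j : Fin n,
    A *ᵥ M.col (Sum.inl j) = symplEig A j • (symplJ n *ᵥ M.col (Sum.inr j)) ∧
    A *ᵥ M.col (Sum.inr j) = -(symplEig A j • (symplJ n *ᵥ M.col (Sum.inl j)))}

/-- `i_m`: the position of `m` inside the block of indices `k` with `d_k(A) = d_m(A)`. -/
def iIdx {n : ℕ} (A : Matrix (Fin n ⊕ Fin n) (Fin n ⊕ Fin n) ℝ) (m : Fin n) : ℕ :=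
  Fintype.card {k : Fin n // k ≤ m ∧ symplEig A k = symplEig A m}

/-- `j_m`: the number of indices `k` after `m` with `d_k(A) = d_m(A)`. -/
def jIdx {n : ℕ} (A : Matrix (Fin n ⊕ Fin n) (Fin n ⊕ Fin n) ℝ) (m : Fin n) : ℕ :=
  Fintype.card {k : Fin n // m < k ∧ symplEig A k = symplEig A m}

/-- `r_m = i_m + j_m`: the multiplicity of `d_m(A)`. -/
def rIdx {n : ℕ} (A : Matrix (Fin n ⊕ Fin n) (Fin n ⊕ Fin n) ℝ) (m : Fin n) : ℕ :=
  iIdx A m + jIdx A m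

theorem one_le_iIdx {n : ℕ} (A : Matrix (Fin n ⊕ Fin n) (Fin n ⊕ Fin n) ℝ) (m : Fin n) :
    1 ≤ iIdx A m :=
  Fintype.card_pos_iff.mpr ⟨⟨m, le_rfl, rfl⟩⟩

theorem iIdx_le {n : ℕ} (A : Matrix (Fin n ⊕ Fin n) (Fin n ⊕ Fin n) ℝ) (m : Fin n) :
    iIdx A m ≤ (m : ℕ) + 1 := by
  rw [iIdx, ← Fin.card_Iic m, Fintype.card_subtype]
  exact Finset.card_le_card fun k hk => Finset.mem_Iic.mpr (Finset.mem_filter.mp hk).2.1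

theorem jIdx_le {n : ℕ} (A : Matrix (Fin n ⊕ Fin n) (Fin n ⊕ Fin n) ℝ) (m : Fin n) :
    jIdx A m ≤ n - 1 - m := by
  rw [jIdx, ← Fin.card_Ioi m, Fintype.card_subtype]
  exact Finset.card_le_card fun k hk => Finset.mem_Ioi.mpr (Finset.mem_filter.mp hk).2.1

theorem block_le {n : ℕ} (A : Matrix (Fin n ⊕ Fin n) (Fin n ⊕ Fin n) ℝ) (m : Fin n) :
    ((m : ℕ) + 1 - iIdx A m) + rIdx A m ≤ n := by
  have h1 := iIdx_le A m
  have h2 := jIdx_le A m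
  have h3 := m.isLt
  simp only [rIdx]
  omega

/-- The block of the symplectic column partition of a `2n`-column matrix `S` that consists of the
columns (1-based) `a + 1, …, a + r, n + a + 1, …, n + a + r`. -/
def symplColBlock {n : ℕ} {ι : Type*} (S : Matrix ι (Fin n ⊕ Fin n) ℝ) (a r : ℕ)
    (h : a + r ≤ n) : Matrix ι (Fin r ⊕ Fin r) ℝ :=
  let c : Fin r → Fin n := fun k => ⟨a + k, by have := k.isLt; omega⟩
  S.submatrix id (Sum.map c c)

/-- `M̃`: the middle block of the symplectic column partition of `M` of order
`(m - i_m, r_m, n - m - j_m)` (with the 1-based `m`). -/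
def tildeBlock {n : ℕ} (A M : Matrix (Fin n ⊕ Fin n) (Fin n ⊕ Fin n) ℝ) (m : Fin n) :
    Matrix (Fin n ⊕ Fin n) (Fin (rIdx A m) ⊕ Fin (rIdx A m)) ℝ :=
  symplColBlock M ((m : ℕ) + 1 - iIdx A m) (rIdx A m) (block_le A m)

/-- `B̃ = -M̃ᵀ B M̃`. -/
def tildeB {n : ℕ} (A M : Matrix (Fin n ⊕ Fin n) (Fin n ⊕ Fin n) ℝ) (m : Fin n)
    (B : Matrix (Fin n ⊕ Fin n) (Fin n ⊕ Fin n) ℝ) :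
    Matrix (Fin (rIdx A m) ⊕ Fin (rIdx A m)) (Fin (rIdx A m) ⊕ Fin (rIdx A m)) ℝ :=
  -((tildeBlock A M m)ᵀ * B * tildeBlock A M m)

/-- For a real matrix `C` with `r × r` blocks `C₁₁, C₁₂, C₂₁, C₂₂`, the complex matrix
`C₁₁ + C₂₂ + i (C₁₂ - C₁₂ᵀ)`. -/
def complexify {r : ℕ} (C : Matrix (Fin r ⊕ Fin r) (Fin r ⊕ Fin r) ℝ) :
    Matrix (Fin r) (Fin r) ℂ :=
  (C.toBlocks₁₁ + C.toBlocks₂₂).map Complex.ofReal +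
    Complex.I • (C.toBlocks₁₂ - C.toBlocks₁₂ᵀ).map Complex.ofReal

theorem isHermitian_complexify {r : ℕ} {C : Matrix (Fin r ⊕ Fin r) (Fin r ⊕ Fin r) ℝ}
    (hC : C.IsSymm) : (complexify C).IsHermitian := by
  ext a b
  have h1 := hC.apply (Sum.inl a) (Sum.inl b)
  have h2 := hC.apply (Sum.inr a) (Sum.inr b)
  simp [complexify, Matrix.toBlocks₁₁, Matrix.toBlocks₂₂, Matrix.toBlocks₁₂, h1, h2]
  ring

theorem isSymm_tildeB {n : ℕ} (A M : Matrix (Fin n ⊕ Fin n) (Fin n ⊕ Fin n) ℝ) (m : Fin n)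
    {B : Matrix (Fin n ⊕ Fin n) (Fin n ⊕ Fin n) ℝ} (hB : B.IsSymm) :
    (tildeB A M m B).IsSymm := by
  have h : Bᵀ = B := hB
  simp [Matrix.IsSymm, tildeB, Matrix.transpose_mul, h, Matrix.mul_assoc]

/-- `λ_j^↓(H)` for `1 ≤ j ≤ r`: the `j`-th largest eigenvalue, counted with multiplicity, of the
`r × r` Hermitian matrix `H`.  (`Matrix.IsHermitian.eigenvalues₀` is the decreasing, 0-based list
of the eigenvalues.) -/
def lamDown {r : ℕ} {H : Matrix (Fin r) (Fin r) ℂ} (hH : H.IsHermitian) (j : ℕ)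
    (h1 : 1 ≤ j) (hr : j ≤ r) : ℝ :=
  hH.eigenvalues₀ ⟨j - 1, by rw [Fintype.card_fin]; omega⟩

/-- `f'(A; B)` exists and equals `L`: one-sided directional derivative. -/
def HasDirDerivAt {ι : Type*} (f : Matrix ι ι ℝ → ℝ) (A B : Matrix ι ι ℝ) (L : ℝ) : Prop :=
  Tendsto (fun t : ℝ => (f (A + t • B) - f A) / t) (𝓝[>] 0) (𝓝 L)

/-- `f` is directionally differentiable at `A` as a function on symmetric matrices. -/
def DirDifferentiableAt {ι : Type*} (f : Matrix ι ι ℝ → ℝ) (A : Matrix ι ι ℝ) : Prop :=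
  ∀ B : Matrix ι ι ℝ, B.IsSymm → ∃ L : ℝ, HasDirDerivAt f A B L

end SymplecticEigenvalues

end

/-! The proof counts the signs of the Hermitian pencil `P + c i J`. A symplectic congruence fixes
`J`, so a Williamson basis followed by the Cayley matrix turns the pencil into the diagonal matrix
with entries `2 (d_k - c)` and `2 (d_k + c)`. By Sylvester's inequality, positivity of the pencil on
a subspace of dimension `(n - m) + n` (with 0-based `m`) forces `c < d_m`, and for `c > 0`
negativity on one of dimension `m + 1` forces `d_m < c` (`lt_of_isRePos_pencil`,
`lt_of_isRePos_neg_pencil`).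

The pencil is affine in `(P, c)`: for `A + tB` at level `d_m(A) + tν` it is the pencil of `A` at
`d_m(A)` plus `t` times the pencil of `B` at `ν`. The first term is singular exactly on the block
belonging to `d_m(A)`; there the second compresses to `-B̃̃ - 2ν`, where `B̃̃` is the Hermitian
matrix of the theorem. Diagonalizing this block (`exists_adapted_basis`) gives entries `b_k - 2ν`
with `b` increasing and `b_m = -λ_{i_m}(B̃̃)`. For small `t > 0` these entries decide the sign on
the kernel, since the coupling to the nonsingular directions is of lower order after rescaling
(`eventually_isRePos_diagonal_add_smul`). Taking `ν = b_m / 2 ± ε` encloses the difference quotient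
between `b_m / 2 - ε` and `b_m / 2 + ε`. -/

noncomputable section

namespace SymplecticEigenvalues

/-! ### Positive forms, degenerate perturbation and inertia -/

section General

set_option linter.unusedSectionVars false

variable {𝕜 : Type*} [RCLike 𝕜] {ι κ : Type*} [Fintype ι] [DecidableEq ι] [Fintype κ]

/-- The real part of the sesquilinear form with matrix `N` is positive definite. -/
def IsRePos {κ : Type*} [Fintype κ] (N : Matrix κ κ 𝕜) : Prop :=
  ∀ x : κ → 𝕜, x ≠ 0 → 0 < RCLike.re (star x ⬝ᵥ (N *ᵥ x))

theorem dotProduct_congr_mulVec (G : Matrix ι κ 𝕜) (N : Matrix ι ι 𝕜) (x : κ → 𝕜) :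
    star x ⬝ᵥ ((Gᴴ * N * G) *ᵥ x) = star (G *ᵥ x) ⬝ᵥ (N *ᵥ (G *ᵥ x)) := by
  rw [Matrix.star_mulVec, ← Matrix.dotProduct_mulVec, Matrix.mulVec_mulVec, Matrix.mulVec_mulVec,
    Matrix.mul_assoc]

theorem IsRePos.congr {N : Matrix ι ι 𝕜} (hN : IsRePos N) {G : Matrix ι κ 𝕜}
    (hG : Function.Injective G.mulVec) : IsRePos (Gᴴ * N * G) := by
  intro x hx
  rw [dotProduct_congr_mulVec]
  exact hN _ fun h => hx (hG (h.trans (Matrix.mulVec_zero G).symm))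

theorem re_star_dotProduct_diagonal (f : ι → ℝ) (x : ι → 𝕜) :
    RCLike.re (star x ⬝ᵥ (Matrix.diagonal (fun k => (f k : 𝕜)) *ᵥ x)) = ∑ k, f k * ‖x k‖ ^ 2 := by
  simp only [dotProduct, Matrix.mulVec_diagonal, map_sum, Pi.star_apply]
  refine Finset.sum_congr rfl fun k _ => ?_
  have : star (x k) * ((f k : 𝕜) * x k) = ((f k * ‖x k‖ ^ 2 : ℝ) : 𝕜) := by
    rw [mul_left_comm, RCLike.star_def, RCLike.conj_mul]
    push_cast
    ring
  rw [this, RCLike.ofReal_re]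

/-- A perturbation with small entries of a positive diagonal matrix is positive
definite. -/
theorem isRePos_diagonal_add {f : ι → ℝ} {E : Matrix ι ι 𝕜} 
    (h : ∀ k, ∑ i, ∑ j, ‖E i j‖ < f k) :
    IsRePos (Matrix.diagonal (fun k => (f k : 𝕜)) + E) := by
  intro x hx
  rw [Matrix.add_mulVec, dotProduct_add, map_add, re_star_dotProduct_diagonal]
  have h1 : -∑ i, ∑ j, ‖E i j‖ * ∑ k, ‖x k‖ ^ 2 ≤ RCLike.re (star x ⬝ᵥ (E *ᵥ x)) := by
    refine neg_le_of_abs_le ((RCLike.abs_re_le_norm _).trans ?_)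
    refine (norm_sum_le _ _).trans (Finset.sum_le_sum fun i _ => ?_)
    rw [norm_mul, Matrix.mulVec, dotProduct, Pi.star_apply, norm_star]
    refine (mul_le_mul_of_nonneg_left (norm_sum_le _ _) (norm_nonneg _)).trans ?_
    rw [Finset.mul_sum]
    refine Finset.sum_le_sum fun j _ => ?_
    rw [norm_mul]
    have hi := Finset.single_le_sum (f := fun k => ‖x k‖ ^ 2) (fun k _ => sq_nonneg _)
      (Finset.mem_univ i)
    have hj := Finset.single_le_sum (f := fun k => ‖x k‖ ^ 2) (fun k _ => sq_nonneg _)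
      (Finset.mem_univ j)
    have : ‖x i‖ * ‖x j‖ ≤ ∑ k, ‖x k‖ ^ 2 := by
      nlinarith [sq_nonneg (‖x i‖ - ‖x j‖)]
    calc ‖x i‖ * (‖E i j‖ * ‖x j‖) = ‖E i j‖ * (‖x i‖ * ‖x j‖) := by ring
      _ ≤ _ := mul_le_mul_of_nonneg_left this (norm_nonneg _)
  have h2 : ∑ i, ∑ j, ‖E i j‖ * ∑ k, ‖x k‖ ^ 2 < ∑ k, f k * ‖x k‖ ^ 2 := by
    simp_rw [← Finset.sum_mul]
    rw [Finset.mul_sum]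
    obtain ⟨k, hk⟩ := Function.ne_iff.1 hx
    refine Finset.sum_lt_sum (fun k _ => ?_) ⟨k, Finset.mem_univ k, ?_⟩
    · exact mul_le_mul_of_nonneg_right (h k).le (sq_nonneg _)
    · exact mul_lt_mul_of_pos_right (h k) (by have := norm_pos_iff.2 hk; positivity)
  linarith

/-- If `κ ≥ 0` and the matrix `Y` is diagonal with positive entries on the zero set of
`κ`, then `diag κ + t Y` is positive definite for small `t > 0`. -/
theorem eventually_isRePos_diagonal_add_smul {f : ι → ℝ} (hf : ∀ k, 0 ≤ f k) {Y : Matrix ι ι 𝕜} {y : ι → ℝ} (hy : ∀ k, f k = 0 → 0 < y k)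
    (hYy : ∀ k l, f k = 0 → f l = 0 → Y k l = if k = l then (y k : 𝕜) else 0) :
    ∀ᶠ t : ℝ in 𝓝[>] 0,
      IsRePos (Matrix.diagonal (fun k => (f k : 𝕜)) + (t : 𝕜) • Y) := by
  classical
  set g : ι → ℝ := fun k => if f k = 0 then y k else f k with hg
  have hg_pos : ∀ k, 0 < g k := by
    intro k
    by_cases h : f k = 0
    · simp [hg, h, hy k h]
    · simpa [hg, h] using lt_of_le_of_ne (hf k) (Ne.symm h)
  -- Here `s` stands for `√t`. Multiplying kernel coordinates by `√t` makes `tY` of order `t`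
  -- relative to the kernel block `t y`, which is absorbed into `g`. Every other entry of the
  -- rescaled `Y` keeps at least one factor `s`, so `E s → 0`.
  set w : ℝ → ι → ℝ := fun s k => if f k = 0 then 1 else s with hw
  -- the rescaled perturbation
  set E : ℝ → Matrix ι ι 𝕜 := fun s => Matrix.of fun k l =>
    if f k = 0 ∧ f l = 0 then 0 else ((w s k * w s l : ℝ) : 𝕜) * Y k l with hEdef
  have hE0 : Tendsto (fun s => ∑ i, ∑ j, ‖E s i j‖) (𝓝 0) (𝓝 0) := by
    have : ∀ i j, Tendsto (fun s => ‖E s i j‖) (𝓝 0) (𝓝 0) := by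
      intro i j
      have hc : Continuous fun s => ‖E s i j‖ := by
        simp only [hEdef, hw, Matrix.of_apply]
        split_ifs <;> fun_prop
      have := hc.tendsto 0
      convert this using 2
      by_cases h1 : f i = 0 <;> by_cases h2 : f j = 0 <;> simp [hEdef, hw, h1, h2]
    simpa using tendsto_finsetSum _ fun i _ => tendsto_finsetSum _ fun j _ => this i j
  have hsmall : ∀ᶠ s in 𝓝 (0 : ℝ), ∀ k, ∑ i, ∑ j, ‖E s i j‖ < g k :=
    eventually_all.2 fun k => hE0.eventually_lt_const (hg_pos k)
  have hsqrt : Tendsto Real.sqrt (𝓝[>] 0) (𝓝 0) := by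
    have := Real.continuous_sqrt.tendsto 0
    rw [Real.sqrt_zero] at this
    exact this.mono_left nhdsWithin_le_nhds
  filter_upwards [hsqrt.eventually hsmall, self_mem_nhdsWithin] with t ht ht0
  have ht0 : 0 < t := ht0
  have hs0 : 0 < √t := Real.sqrt_pos.2 ht0
  have hst : √t * √t = t := Real.mul_self_sqrt ht0.le
  have hP := isRePos_diagonal_add ht
  have hv : ∀ k, w √t k ≠ 0 := by
    intro k
    simp only [hw]
    split_ifs
    · exact one_ne_zero
    · exact hs0.ne'
  -- congruence by the diagonal scaling matrix
  set D : Matrix ι ι 𝕜 := Matrix.diagonal fun k => ((√t / w √t k : ℝ) : 𝕜) with hD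
  have key : Matrix.diagonal (fun k => (f k : 𝕜)) + (t : 𝕜) • Y =
      Dᴴ * (Matrix.diagonal (fun k => (g k : 𝕜)) + E √t) * D := by
    ext k l
    simp only [hD, Matrix.diagonal_conjTranspose, Matrix.mul_diagonal, Matrix.diagonal_mul,
      Matrix.add_apply, Matrix.smul_apply, Pi.star_apply, RCLike.star_def, RCLike.conj_ofReal,
      smul_eq_mul, Matrix.diagonal_apply, hEdef, Matrix.of_apply]
    have hst' : (√t : 𝕜) * (√t : 𝕜) = (t : 𝕜) := by
      rw [← RCLike.ofReal_mul, hst]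
    have hs0' : (√t : 𝕜) ≠ 0 := by exact_mod_cast hs0.ne'
    by_cases h1 : f k = 0 <;> by_cases h2 : f l = 0
    · rw [hYy k l h1 h2]
      by_cases h : k = l
      · subst h
        simp [hg, hw, h1]
        rw [← hst']; ring
      · simp [h, h1, h2]
    · have h : k ≠ l := by rintro rfl; exact h2 h1
      simp [hw, h1, h2, h]
      field_simp
      rw [← hst']; ring
    · have h : k ≠ l := by rintro rfl; exact h1 h2
      simp [hw, h1, h2, h]
      field_simp
      rw [← hst']; ring
    · by_cases h : k = l
      · subst h
        simp [hg, hw, h1]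
        field_simp
        rw [← hst']; ring
      · simp [hw, h1, h2, h]
        field_simp
        rw [← hst']; ring
  rw [key]
  refine hP.congr ?_
  rw [Matrix.mulVec_injective_iff_isUnit, Matrix.isUnit_iff_isUnit_det, hD, Matrix.det_diagonal,
    isUnit_iff_ne_zero, Finset.prod_ne_zero_iff]
  intro k _
  exact_mod_cast (div_ne_zero hs0.ne' (hv k))

/-- Sylvester's inequality: if `F` is congruent to `diag f` and positive definite on the column
space of `G`, then `G` has at most as many columns as `f` has positive entries. -/
theorem card_le_card_pos {F G₁ : Matrix ι ι 𝕜} {f : ι → ℝ} (hG₁ : IsUnit G₁)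
    (h₁ : G₁ᴴ * F * G₁ = Matrix.diagonal (fun k => (f k : 𝕜))) {G : Matrix ι κ 𝕜}
    (hG : IsRePos (Gᴴ * F * G)) :
    Fintype.card κ ≤ Fintype.card {k // 0 < f k} := by
  classical
  -- Only the positive coordinates of `G₁⁻¹ G x` are kept. If they all vanish, the form at `G x` is
  -- a sum of nonpositive terms, so `x = 0`.
  set φ : (κ → 𝕜) →ₗ[𝕜] ({k // 0 < f k} → 𝕜) :=
    (LinearMap.funLeft 𝕜 𝕜 Subtype.val) ∘ₗ (G₁⁻¹ * G).mulVecLin with hφ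
  have hinj : Function.Injective φ := by
    rw [← LinearMap.ker_eq_bot, LinearMap.ker_eq_bot']
    intro x hx
    by_contra hne
    have hpos := hG x hne
    set w := (G₁⁻¹ * G) *ᵥ x with hwdef
    have hw : G = G₁ * (G₁⁻¹ * G) := by
      rw [← Matrix.mul_assoc, Matrix.mul_nonsing_inv _ ((Matrix.isUnit_iff_isUnit_det _).1 hG₁),
        Matrix.one_mul]
    have hGw : G₁ *ᵥ w = G *ᵥ x := by rw [hwdef, Matrix.mulVec_mulVec, ← hw]
    have : star x ⬝ᵥ ((Gᴴ * F * G) *ᵥ x)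
        = star w ⬝ᵥ (Matrix.diagonal (fun k => (f k : 𝕜)) *ᵥ w) := by
      rw [← h₁, dotProduct_congr_mulVec, dotProduct_congr_mulVec, hGw]
    rw [this, re_star_dotProduct_diagonal] at hpos
    refine absurd hpos (not_lt.2 (Finset.sum_nonpos fun k _ => ?_))
    by_cases hk : 0 < f k
    · have : w k = 0 := congrFun hx ⟨k, hk⟩
      simp [this]
    · exact mul_nonpos_of_nonpos_of_nonneg (not_lt.1 hk) (sq_nonneg _)
  have := LinearMap.finrank_le_finrank_of_injective hinj
  simpa using this

end General

/-! ### Ordered diagonalization and blocks of equal eigenvalues -/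

/-- Spectral theorem with the eigenvalues in decreasing order. -/
theorem exists_unitary_diagonal_eigenvalues₀ {𝕜 : Type*} [RCLike 𝕜] {r : ℕ}
    {H : Matrix (Fin r) (Fin r) 𝕜} (hH : H.IsHermitian) :
    ∃ W : Matrix (Fin r) (Fin r) 𝕜, Wᴴ * W = 1 ∧
      Wᴴ * H * W = Matrix.diagonal
        (fun k => (hH.eigenvalues₀ (Fin.cast (Fintype.card_fin r).symm k) : 𝕜)) := by
  set V : Matrix (Fin r) (Fin r) 𝕜 := hH.eigenvectorUnitary.1 with hV
  have hV1 : Vᴴ * V = 1 := Unitary.coe_star_mul_self hH.eigenvectorUnitary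
  have hV2 : Vᴴ * H * V = Matrix.diagonal (RCLike.ofReal ∘ hH.eigenvalues) := by
    have := hH.conjStarAlgAut_star_eigenvectorUnitary
    rw [Unitary.conjStarAlgAut_star_apply] at this
    exact this
  -- `eigenvalues` is `eigenvalues₀` read through an arbitrary equivalence of index types; `σ`
  -- undoes that reindexing.
  set σ : Fin r ≃ Fin r := (finCongr (Fintype.card_fin r).symm).trans
    (Fintype.equivOfCardEq (Fintype.card_fin _)) with hσ
  refine ⟨V.submatrix id σ, ?_, ?_⟩
  · have : (V.submatrix id σ)ᴴ * V.submatrix id σ = (Vᴴ * V).submatrix σ σ := rfl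
    rw [this, hV1, Matrix.submatrix_one_equiv]
  · have : (V.submatrix id σ)ᴴ * H * V.submatrix id σ = (Vᴴ * H * V).submatrix σ σ := rfl
    rw [this, hV2, Matrix.submatrix_diagonal_equiv]
    congr 1
    ext k
    simp [Matrix.IsHermitian.eigenvalues, hσ]

/-- A unitary `r × r` matrix extended by the identity along an injection `Fin r → Fin n`. -/
theorem exists_unitary_extension {𝕜 : Type*} [RCLike 𝕜] {r n : ℕ} {c : Fin r → Fin n}
    (hc : Function.Injective c) {W : Matrix (Fin r) (Fin r) 𝕜} (hW : Wᴴ * W = 1) :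
    ∃ U : Matrix (Fin n) (Fin n) 𝕜,
      (∀ f : Fin n → 𝕜, (∀ k l, f (c k) = f (c l)) →
        Uᴴ * Matrix.diagonal f * U = Matrix.diagonal f) ∧
      ∀ (X : Matrix (Fin n) (Fin n) 𝕜) (k l : Fin r),
        (Uᴴ * X * U) (c k) (c l) = (Wᴴ * X.submatrix c c * W) k l := by
  classical
  set e : Fin r ⊕ {k // k ∉ Set.range c} ≃ Fin n :=
    (Equiv.sumCongr (Equiv.ofInjective c hc) (Equiv.refl _)).trans
      (Equiv.Set.sumCompl (Set.range c)) with he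
  have hel : ∀ k, e (Sum.inl k) = c k := fun k => rfl
  have hel' : ∀ k, e.symm (c k) = Sum.inl k := fun k => by rw [← hel, Equiv.symm_apply_apply]
  set U' : Matrix (Fin r ⊕ {k // k ∉ Set.range c}) (Fin r ⊕ {k // k ∉ Set.range c}) 𝕜 :=
    Matrix.fromBlocks W 0 0 1 with hU'
  have hX : ∀ X : Matrix (Fin n) (Fin n) 𝕜,
      (U'.submatrix e.symm e.symm)ᴴ * X * U'.submatrix e.symm e.symm
        = (U'ᴴ * X.submatrix e e * U').submatrix e.symm e.symm := by
    intro X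
    rw [← Matrix.submatrix_mul_equiv _ _ _ e.symm, ← Matrix.submatrix_mul_equiv _ _ _ e.symm]
    simp
  refine ⟨U'.submatrix e.symm e.symm, fun f hf => ?_, fun X k l => ?_⟩
  · have hd : (Matrix.diagonal f).submatrix e e = Matrix.fromBlocks
        (Matrix.diagonal fun k => f (c k)) 0 0
        (Matrix.diagonal fun k : {k // k ∉ Set.range c} => f k) := by
      rw [Matrix.submatrix_diagonal_equiv, Matrix.fromBlocks_diagonal]
      congr 1
      ext k
      cases k <;> rfl
    -- Since `f` is constant on the range of `c`, this block is scalar and is unchanged by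
    -- conjugation with a unitary.
    have hW' : Wᴴ * (Matrix.diagonal fun k => f (c k)) * W =
        Matrix.diagonal fun k => f (c k) := by
      rcases isEmpty_or_nonempty (Fin r) with h | ⟨⟨k₀⟩⟩
      · exact Subsingleton.elim _ _
      · have : (Matrix.diagonal fun k => f (c k)) = f (c k₀) • (1 : Matrix (Fin r) (Fin r) 𝕜) := by
          rw [Matrix.smul_one_eq_diagonal]
          congr 1
          ext k
          exact hf k k₀
        rw [this, Matrix.mul_smul, Matrix.smul_mul, Matrix.mul_one, hW]
    have : U'ᴴ * (Matrix.diagonal f).submatrix e e * U' = (Matrix.diagonal f).submatrix e e := by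
      rw [hd, hU', Matrix.fromBlocks_conjTranspose, Matrix.fromBlocks_multiply,
        Matrix.fromBlocks_multiply]
      simp [hW']
    rw [hX, this]
    simp
  · rw [hX, Matrix.submatrix_apply, hel', hel']
    have hb : X.submatrix e e = Matrix.fromBlocks (X.submatrix c c)
        (X.submatrix c Subtype.val) (X.submatrix Subtype.val c)
        (X.submatrix Subtype.val Subtype.val) := by
      ext a b
      cases a <;> cases b <;> rfl
    rw [hb, hU', Matrix.fromBlocks_conjTranspose, Matrix.fromBlocks_multiply,
      Matrix.fromBlocks_multiply]
    simp

/-- The level sets of a monotone sequence are intervals. -/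
theorem eq_iff_of_monotone {n : ℕ} {d : Fin n → ℝ} (hd : Monotone d) (m k : Fin n) {i j : ℕ}
    (hi : Fintype.card {k : Fin n // k ≤ m ∧ d k = d m} = i)
    (hj : Fintype.card {k : Fin n // m < k ∧ d k = d m} = j) :
    d k = d m ↔ (m : ℕ) + 1 ≤ k + i ∧ (k : ℕ) ≤ m + j := by
  rw [Fintype.card_subtype] at hi hj
  have hj0 : ∀ l : Fin n, m < l → d l = d m → (l : ℕ) ≤ m + j := by
    intro l hl h
    have : Finset.Ioc m l ⊆ Finset.univ.filter fun k => m < k ∧ d k = d m := by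
      intro x hx
      rw [Finset.mem_Ioc] at hx
      simpa using ⟨hx.1, le_antisymm (h ▸ hd hx.2) (hd hx.1.le)⟩
    have := Finset.card_le_card this
    rw [Fin.card_Ioc, hj] at this
    omega
  constructor
  · intro h
    constructor
    · rcases le_total m k with hk | hk
      · have : 0 < i := hi ▸ Finset.card_pos.2 ⟨m, by simp⟩
        have : (m : ℕ) ≤ k := hk
        omega
      · have : Finset.Icc k m ⊆ Finset.univ.filter fun k => k ≤ m ∧ d k = d m := by
          intro x hx
          rw [Finset.mem_Icc] at hx
          simpa using ⟨hx.2, le_antisymm (hd hx.2) (h ▸ hd hx.1)⟩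
        have := Finset.card_le_card this
        rw [Fin.card_Icc, hi] at this
        omega
    · rcases lt_or_ge m k with hk | hk
      · exact hj0 k hk h
      · have : (k : ℕ) ≤ m := hk
        omega
  · rintro ⟨h1, h2⟩
    by_contra hne
    rcases lt_or_gt_of_ne hne with hlt | hlt
    · have hkm : (k : ℕ) < m := lt_of_not_ge fun h => hlt.not_ge (hd h)
      -- If `d k < d m`, the part of the level set up to `m` lies in `(k, m]`, which has only `m - k
      -- < i` elements.
      have : (Finset.univ.filter fun k => k ≤ m ∧ d k = d m) ⊆ Finset.Ioc k m := by
        intro x hx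
        simp only [Finset.mem_filter, Finset.mem_univ, true_and] at hx
        rw [Finset.mem_Ioc]
        exact ⟨lt_of_not_ge fun h => (hx.2 ▸ hlt).not_ge (hd h), hx.1⟩
      have := Finset.card_le_card this
      rw [Fin.card_Ioc, hi] at this
      omega
    · have hkm : (m : ℕ) < k := lt_of_not_ge fun h => hlt.not_ge (hd h)
      have : (Finset.univ.filter fun k => m < k ∧ d k = d m) ⊆ Finset.Ioo m k := by
        intro x hx
        simp only [Finset.mem_filter, Finset.mem_univ, true_and] at hx
        rw [Finset.mem_Ioo]
        exact ⟨hx.1, lt_of_not_ge fun h => (hx.2 ▸ hlt).not_ge (hd h)⟩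
      have := Finset.card_le_card this
      rw [Fin.card_Ioo, hj] at this
      omega

/-! ### Existence of the Williamson normal form -/

theorem exists_unitary_diagonal {𝕜 ι : Type*} [RCLike 𝕜] [Fintype ι] [DecidableEq ι]
    {H : Matrix ι ι 𝕜} (hH : H.IsHermitian) :
    ∃ V : Matrix ι ι 𝕜, Vᴴ * V = 1 ∧
      H * V = V * Matrix.diagonal (fun k => (hH.eigenvalues k : 𝕜)) := by
  have hV1 : (hH.eigenvectorUnitary.1)ᴴ * hH.eigenvectorUnitary.1 = 1 :=
    Unitary.coe_star_mul_self hH.eigenvectorUnitary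
  have hV1' : hH.eigenvectorUnitary.1 * (hH.eigenvectorUnitary.1)ᴴ = 1 :=
    Unitary.coe_mul_star_self hH.eigenvectorUnitary
  refine ⟨hH.eigenvectorUnitary.1, hV1, ?_⟩
  have := hH.conjStarAlgAut_star_eigenvectorUnitary
  rw [Unitary.conjStarAlgAut_star_apply] at this
  have h2 : (hH.eigenvectorUnitary.1)ᴴ * H * hH.eigenvectorUnitary.1 =
    Matrix.diagonal (fun k => (hH.eigenvalues k : 𝕜)) := this
  rw [← h2, Matrix.mul_assoc, ← Matrix.mul_assoc _ (_ᴴ), hV1', Matrix.one_mul]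

/-- A positive definite form has an orthonormal basis. -/
theorem exists_congr_one {ι : Type*} [Fintype ι] [DecidableEq ι] {A : Matrix ι ι ℝ}
    (hA : A.PosDef) : ∃ R : Matrix ι ι ℝ, IsUnit R ∧ Rᵀ * A * R = 1 := by
  obtain ⟨V, hV1, hV2⟩ := exists_unitary_diagonal hA.isHermitian
  have hpos : ∀ k, 0 < hA.isHermitian.eigenvalues k := hA.eigenvalues_pos
  set l := hA.isHermitian.eigenvalues
  rw [Matrix.conjTranspose_eq_transpose_of_trivial] at hV1
  refine ⟨V * Matrix.diagonal fun k => (√(l k))⁻¹, ?_, ?_⟩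
  · refine IsUnit.mul (IsUnit.of_mul_eq_one_right _ hV1) ?_
    rw [Matrix.isUnit_iff_isUnit_det, Matrix.det_diagonal, isUnit_iff_ne_zero,
      Finset.prod_ne_zero_iff]
    exact fun k _ => inv_ne_zero (Real.sqrt_ne_zero'.2 (hpos k))
  · rw [Matrix.transpose_mul, Matrix.diagonal_transpose]
    calc _ = Matrix.diagonal (fun k => (√(l k))⁻¹) * (Vᵀ * (A * V)) *
          Matrix.diagonal (fun k => (√(l k))⁻¹) := by simp only [Matrix.mul_assoc]
      _ = 1 := by
        rw [hV2, ← Matrix.mul_assoc Vᵀ, hV1, Matrix.one_mul, Matrix.diagonal_mul_diagonal,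
          Matrix.diagonal_mul_diagonal, ← Matrix.diagonal_one]
        congr 1
        ext k
        have h1 := Real.mul_self_sqrt (hpos k).le
        have h2 := Real.sqrt_ne_zero'.2 (hpos k)
        simp only [RCLike.ofReal_real_eq_id, id]
        nth_rw 2 [← h1]
        field_simp

/-- Normal form of an invertible skew-symmetric real matrix. -/
theorem exists_skew_normal_form {n : ℕ} {S : Matrix (Fin n ⊕ Fin n) (Fin n ⊕ Fin n) ℝ}
    (hS : Sᵀ = -S) (hSu : IsUnit S) :
    ∃ (μ : Fin n → ℝ) (X Y : Matrix (Fin n ⊕ Fin n) (Fin n) ℝ), (∀ k, 0 < μ k) ∧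
      Xᵀ * X = 1 ∧ Yᵀ * Y = 1 ∧ Xᵀ * Y = 0 ∧
      S * X = Y * Matrix.diagonal μ ∧ S * Y = -(X * Matrix.diagonal μ) := by
  set H : Matrix (Fin n ⊕ Fin n) (Fin n ⊕ Fin n) ℂ := Complex.I • S.map Complex.ofReal with hHdef
  have hS' : ∀ a b, S b a = -S a b := fun a b => congrFun (congrFun hS a) b
  have hH : H.IsHermitian := by
    ext a b
    simp [hHdef, hS' a b]
  have hHT : Hᵀ = -H := by
    ext a b
    simp [hHdef, hS' a b]
  obtain ⟨V, hV1, hV2⟩ := exists_unitary_diagonal hH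
  set l := hH.eigenvalues with hl
  have hl0 : ∀ k, l k ≠ 0 := by
    have hdet : H.det ≠ 0 := by
      have h1 : S.det ≠ 0 := isUnit_iff_ne_zero.1 ((Matrix.isUnit_iff_isUnit_det _).1 hSu)
      have h2 : (S.map Complex.ofReal).det = ((S.det : ℝ) : ℂ) :=
        (RingHom.map_det Complex.ofRealHom S).symm
      rw [hHdef, Matrix.det_smul, h2]
      exact mul_ne_zero (pow_ne_zero _ Complex.I_ne_zero) (by exact_mod_cast h1)
    rw [hH.det_eq_prod_eigenvalues, Finset.prod_ne_zero_iff] at hdet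
    intro k hk
    exact hdet k (Finset.mem_univ k) (by rw [← hl, hk]; simp)
  -- As `Hᵀ = -H`, conjugating an eigenvector negates its eigenvalue; orthogonality of distinct
  -- eigenspaces becomes vanishing of the bilinear product.
  have hQ : ∀ i j, l i + l j ≠ 0 → (Vᵀ * V) i j = 0 := by
    intro i j hij
    have h1 : Vᵀ * H * V = Vᵀ * V * Matrix.diagonal (fun k => (l k : ℂ)) := by
      rw [Matrix.mul_assoc, hV2, Matrix.mul_assoc]
      rfl
    have h2 : (Vᵀ * H * V)ᵀ = -(Vᵀ * H * V) := by
      simp [Matrix.transpose_mul, hHT, Matrix.mul_assoc]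
    rw [h1, Matrix.transpose_mul, Matrix.transpose_mul, Matrix.transpose_transpose,
      Matrix.diagonal_transpose] at h2
    have h3 := congrFun (congrFun h2 i) j
    rw [Matrix.diagonal_mul, Matrix.neg_apply, Matrix.mul_diagonal] at h3
    have h4 : ((l i + l j : ℝ) : ℂ) * (Vᵀ * V) i j = 0 := by
      push_cast
      linear_combination h3
    exact (mul_eq_zero.1 h4).resolve_left (by exact_mod_cast hij)
  -- If no two selected eigenvalues sum to zero, the selected eigenvectors and their conjugates are
  -- orthonormal together, so twice their number is at most `2n`. Applied to the positive and to the
  -- negative eigenvalues, this leaves exactly `n` of each.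
  have hcard : ∀ (p : Fin n ⊕ Fin n → Prop) [DecidablePred p], (∀ i j, p i → p j → l i + l j ≠ 0) →
      Fintype.card {i // p i} ≤ n := by
    intro p _ hp
    set Z : Matrix (Fin n ⊕ Fin n) {i // p i} ℂ := V.submatrix id Subtype.val with hZ
    have hZ1 : Zᴴ * Z = 1 := by
      have : Zᴴ * Z = (Vᴴ * V).submatrix Subtype.val Subtype.val := rfl
      rw [this, hV1]
      exact Matrix.submatrix_one _ Subtype.val_injective
    have hZ2 : Zᵀ * Z = 0 := by
      ext i j
      exact hQ i j (hp i j i.2 j.2)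
    set G := Matrix.fromCols Z (Zᵀ)ᴴ with hG
    have hGG : Gᴴ * G = 1 := by
      rw [hG, Matrix.conjTranspose_fromCols_eq_fromRows_conjTranspose,
        Matrix.fromRows_mul_fromCols, Matrix.conjTranspose_conjTranspose, hZ1, hZ2,
        ← Matrix.conjTranspose_mul, hZ2]
      have : Zᵀ * Zᵀᴴ = 1 := by
        have := congrArg Matrix.transpose hZ1
        rw [Matrix.transpose_mul, Matrix.transpose_one] at this
        exact this
      rw [this, Matrix.conjTranspose_zero, Matrix.fromBlocks_one]
    have hinj : Function.Injective G.mulVecLin := by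
      intro x y hxy
      have := congrArg (Gᴴ *ᵥ ·) hxy
      simpa [Matrix.mulVec_mulVec, hGG] using this
    have := LinearMap.finrank_le_finrank_of_injective hinj
    simp only [Module.finrank_fintype_fun_eq_card, Fintype.card_sum, Fintype.card_fin] at this
    omega
  have hpos : Fintype.card {i // 0 < l i} = n := by
    have h1 := hcard (fun i => 0 < l i) fun i j hi hj => (add_pos hi hj).ne'
    have h2 := hcard (fun i => ¬ 0 < l i) fun i j hi hj => by
      have := lt_of_le_of_ne (not_lt.1 hi) (hl0 i)
      have := lt_of_le_of_ne (not_lt.1 hj) (hl0 j)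
      linarith
    have h3 := Fintype.card_congr (Equiv.sumCompl fun i => 0 < l i)
    rw [Fintype.card_sum, Fintype.card_sum, Fintype.card_fin] at h3
    omega
  obtain ⟨e⟩ : Nonempty (Fin n ≃ {i // 0 < l i}) :=
    ⟨(Fintype.equivFinOfCardEq hpos).symm⟩
  set Z : Matrix (Fin n ⊕ Fin n) (Fin n) ℂ := V.submatrix id (fun k => (e k).1) with hZ
  have hinj : Function.Injective fun k => (e k).1 := Subtype.val_injective.comp e.injective
  have hZ1 : Zᴴ * Z = 1 := by
    have : Zᴴ * Z = (Vᴴ * V).submatrix (fun k => (e k).1) (fun k => (e k).1) := rfl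
    rw [this, hV1]
    exact Matrix.submatrix_one _ hinj
  have hZ2 : Zᵀ * Z = 0 := by
    ext i j
    exact hQ (e i) (e j) (add_pos (e i).2 (e j).2).ne'
  have hSZ : ∀ a k, Complex.I * ∑ b, (S a b : ℂ) * Z b k = l (e k) * Z a k := by
    intro a k
    have := congrFun (congrFun hV2 a) (e k)
    rw [Matrix.mul_diagonal, Matrix.mul_apply] at this
    rw [Finset.mul_sum, mul_comm]
    rw [mul_comm] at this
    simpa [hHdef, hZ, mul_assoc, mul_comm, mul_left_comm] using this
  have h2 : √2 * √2 = (2 : ℝ) := Real.mul_self_sqrt zero_le_two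
  -- Real and imaginary parts of `Zᴴ Z = 1` and `Zᵀ Z = 0` give `XᵀX = YᵀY = 1/2` and `XᵀY = 0`,
  -- whence the factor `√2` in the final vectors.
  set X : Matrix (Fin n ⊕ Fin n) (Fin n) ℝ := Z.map Complex.re with hX
  set Y : Matrix (Fin n ⊕ Fin n) (Fin n) ℝ := Z.map Complex.im with hY
  have hre1 : Xᵀ * X + Yᵀ * Y = 1 := by
    ext i j
    have := congrArg Complex.re (congrFun (congrFun hZ1 i) j)
    simp only [Matrix.mul_apply, Matrix.conjTranspose_apply, Complex.re_sum, RCLike.star_def,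
      Complex.mul_re, Complex.conj_re, Complex.conj_im, Matrix.one_apply, Finset.sum_sub_distrib,
      neg_mul, Finset.sum_neg_distrib] at this
    simp only [Matrix.add_apply, Matrix.mul_apply, Matrix.transpose_apply, hX, hY,
      Matrix.map_apply, Matrix.one_apply]
    rw [← sub_neg_eq_add, this]
    split_ifs <;> simp
  have hre2 : Xᵀ * X - Yᵀ * Y = 0 := by
    ext i j
    have := congrArg Complex.re (congrFun (congrFun hZ2 i) j)
    simp only [Matrix.mul_apply, Matrix.transpose_apply, Complex.re_sum, Complex.mul_re,
      Finset.sum_sub_distrib, Matrix.zero_apply, Complex.zero_re] at this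
    simpa only [Matrix.sub_apply, Matrix.mul_apply] using! this
  have him1 : Xᵀ * Y - Yᵀ * X = 0 := by
    ext i j
    have := congrArg Complex.im (congrFun (congrFun hZ1 i) j)
    simp only [Matrix.mul_apply, Matrix.conjTranspose_apply, Complex.im_sum, RCLike.star_def,
      Complex.mul_im, Complex.conj_re, Complex.conj_im, Matrix.one_apply, Finset.sum_add_distrib,
      neg_mul, Finset.sum_neg_distrib] at this
    simp only [Matrix.sub_apply, Matrix.mul_apply, Matrix.transpose_apply, hX, hY,
      Matrix.map_apply, Matrix.zero_apply]
    rw [sub_eq_add_neg, this]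
    split_ifs <;> simp
  have him2 : Xᵀ * Y + Yᵀ * X = 0 := by
    ext i j
    have := congrArg Complex.im (congrFun (congrFun hZ2 i) j)
    simp only [Matrix.mul_apply, Matrix.transpose_apply, Complex.im_sum, Complex.mul_im,
      Finset.sum_add_distrib, Matrix.zero_apply, Complex.zero_im] at this
    simpa only [Matrix.add_apply, Matrix.mul_apply] using! this
  have hXX : (2 : ℝ) • (Xᵀ * X) = 1 := by
    rw [two_smul]; nth_rw 2 [sub_eq_zero.1 hre2]; exact hre1
  have hYY : (2 : ℝ) • (Yᵀ * Y) = 1 := by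
    rw [two_smul]; nth_rw 1 [← sub_eq_zero.1 hre2]; exact hre1
  have hXY : (2 : ℝ) • (Xᵀ * Y) = 0 := by
    rw [two_smul]; nth_rw 2 [sub_eq_zero.1 him1]; exact him2
  refine ⟨fun k => l (e k), √2 • X, √2 • Y, fun k => (e k).2, ?_, ?_, ?_, ?_, ?_⟩
  · simp only [Matrix.transpose_smul, Matrix.smul_mul, Matrix.mul_smul, smul_smul, h2, hXX]
  · simp only [Matrix.transpose_smul, Matrix.smul_mul, Matrix.mul_smul, smul_smul, h2, hYY]
  · simp only [Matrix.transpose_smul, Matrix.smul_mul, Matrix.mul_smul, smul_smul, h2, hXY]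
  · rw [Matrix.smul_mul, Matrix.mul_smul]
    congr 1
    ext a k
    have := congrArg Complex.im (hSZ a k)
    rw [Matrix.mul_diagonal]
    simpa [Matrix.mul_apply, hX, hY, Complex.mul_im, Complex.mul_re,
      mul_comm] using this
  · rw [Matrix.smul_mul, Matrix.mul_smul, ← smul_neg]
    congr 1
    ext a k
    have := congrArg Complex.re (hSZ a k)
    rw [Matrix.neg_apply, Matrix.mul_diagonal, ← neg_eq_iff_eq_neg]
    simpa [Matrix.mul_apply, hX, hY, Complex.mul_im, Complex.mul_re,
      mul_comm] using this

theorem symplJ_transpose (n : ℕ) : (symplJ n)ᵀ = -symplJ n := by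
  simp [symplJ, Matrix.fromBlocks_transpose, Matrix.fromBlocks_neg]

theorem symplJ_mul_self (n : ℕ) : symplJ n * symplJ n = -1 := by
  simp [symplJ, Matrix.fromBlocks_multiply, ← Matrix.fromBlocks_one, Matrix.fromBlocks_neg]

theorem isUnit_symplJ (n : ℕ) : IsUnit (symplJ n) :=
  IsUnit.of_mul_eq_one (-symplJ n) (by rw [Matrix.mul_neg, symplJ_mul_self, neg_neg])

/-- **Williamson's theorem** (existence). -/
theorem exists_isWilliamsonDiagonal {n : ℕ} {A : Matrix (Fin n ⊕ Fin n) (Fin n ⊕ Fin n) ℝ}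
    (hA : A.PosDef) : ∃ d, IsWilliamsonDiagonal A d := by
  obtain ⟨R, hRu, hR⟩ := exists_congr_one hA
  have hSskew : (Rᵀ * symplJ n * R)ᵀ = -(Rᵀ * symplJ n * R) := by
    simp [Matrix.transpose_mul, symplJ_transpose, Matrix.mul_assoc]
  obtain ⟨μ, X, Y, hμ, hXX, hYY, hXY, hSX, hSY⟩ := exists_skew_normal_form hSskew
    (((Matrix.isUnit_transpose R).2 hRu |>.mul (isUnit_symplJ n)).mul hRu)
  have hYX : Yᵀ * X = 0 := by
    have := congrArg Matrix.transpose hXY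
    simpa [Matrix.transpose_mul] using this
  set s : Matrix (Fin n) (Fin n) ℝ := Matrix.diagonal fun k => (√(μ k))⁻¹ with hs
  have hsT : sᵀ = s := Matrix.diagonal_transpose _
  have hsμ : s * Matrix.diagonal μ * s = 1 := by
    rw [hs, Matrix.diagonal_mul_diagonal, Matrix.diagonal_mul_diagonal, ← Matrix.diagonal_one]
    congr 1
    ext k
    have h1 := Real.mul_self_sqrt (hμ k).le
    have h2 := Real.sqrt_ne_zero'.2 (hμ k)
    nth_rw 2 [← h1]
    field_simp
  have hss : s * s = Matrix.diagonal fun k => (μ k)⁻¹ := by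
    rw [hs, Matrix.diagonal_mul_diagonal]
    congr 1
    ext k
    rw [← mul_inv, Real.mul_self_sqrt (hμ k).le]
  set σ := Tuple.sort fun k => (μ k)⁻¹ with hσ
  -- `Y` comes first because `Yᵀ S X = diag μ` must become the block `+1` of `J`. The scaling by
  -- `μ^(-1/2)` achieves this and turns the identity, the form of `A`, into `diag (1/μ)`.
  set O := Matrix.fromCols (Y * s) (X * s) with hO
  have hOO : Oᵀ * O = Matrix.fromBlocks (s * s) 0 0 (s * s) := by
    rw [hO, Matrix.transpose_fromCols, Matrix.fromRows_mul_fromCols, Matrix.transpose_mul,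
      Matrix.transpose_mul, hsT]
    have h : ∀ P Q : Matrix (Fin n ⊕ Fin n) (Fin n) ℝ, s * Pᵀ * (Q * s) = s * (Pᵀ * Q) * s :=
      fun P Q => by simp only [Matrix.mul_assoc]
    rw [h, h, h, h, hXX, hYY, hXY, hYX]
    simp
  have hOS : Oᵀ * (Rᵀ * symplJ n * R) * O = symplJ n := by
    rw [Matrix.mul_assoc, hO, Matrix.mul_fromCols, ← Matrix.mul_assoc, ← Matrix.mul_assoc,
      hSX, hSY, Matrix.transpose_fromCols, Matrix.fromRows_mul_fromCols, Matrix.transpose_mul,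
      Matrix.transpose_mul, hsT]
    have h : ∀ P Q : Matrix (Fin n ⊕ Fin n) (Fin n) ℝ,
        s * Pᵀ * (Q * Matrix.diagonal μ * s) = s * (Pᵀ * Q) * Matrix.diagonal μ * s :=
      fun P Q => by simp only [Matrix.mul_assoc]
    rw [Matrix.neg_mul, Matrix.mul_neg, Matrix.mul_neg, h, h, h, h, hXX, hYY, hXY, hYX]
    simp [hsμ, symplJ]
  refine ⟨(fun k => (μ k)⁻¹) ∘ σ, Tuple.monotone_sort _, fun k => inv_pos.2 (hμ _),
    (R * O).submatrix id (Sum.map σ σ), ?_, ?_⟩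
  · have h1 : ((R * O).submatrix id (Sum.map σ σ))ᵀ * symplJ n *
        (R * O).submatrix id (Sum.map σ σ) =
        ((R * O)ᵀ * symplJ n * (R * O)).submatrix (Sum.map σ σ) (Sum.map σ σ) := rfl
    have h2 : (R * O)ᵀ * symplJ n * (R * O) = Oᵀ * (Rᵀ * symplJ n * R) * O := by
      simp only [Matrix.transpose_mul, Matrix.mul_assoc]
    rw [IsSymplectic, h1, h2, hOS]
    ext a b
    cases a <;> cases b <;> simp [symplJ, Matrix.one_apply]
  · have h1 : ((R * O).submatrix id (Sum.map σ σ))ᵀ * A *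
        (R * O).submatrix id (Sum.map σ σ) =
        ((R * O)ᵀ * A * (R * O)).submatrix (Sum.map σ σ) (Sum.map σ σ) := rfl
    have h2 : (R * O)ᵀ * A * (R * O) = Oᵀ * (Rᵀ * A * R) * O := by
      simp only [Matrix.transpose_mul, Matrix.mul_assoc]
    rw [h1, h2, hR, Matrix.mul_one, hOO, hss]
    ext a b
    cases a <;> cases b <;> simp [Matrix.diagonal_apply]

/-! ### The Hermitian pencil and the counting of its signs -/

variable {n : ℕ}

/-- The Hermitian pencil `P + c i J`. -/
def pencil (P : Matrix (Fin n ⊕ Fin n) (Fin n ⊕ Fin n) ℝ) (c : ℝ) :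
    Matrix (Fin n ⊕ Fin n) (Fin n ⊕ Fin n) ℂ :=
  P.map Complex.ofReal + ((c : ℂ) * Complex.I) • (symplJ n).map Complex.ofReal

/-- The Cayley matrix, whose columns are (unnormalised) eigenvectors of `i J`. -/
def cayley (n : ℕ) : Matrix (Fin n ⊕ Fin n) (Fin n ⊕ Fin n) ℂ :=
  Matrix.fromBlocks 1 1 (Complex.I • 1) (-Complex.I • 1)

theorem isUnit_cayley (n : ℕ) : IsUnit (cayley n) := by
  refine IsUnit.of_mul_eq_one ((1 / 2 : ℂ) • (cayley n)ᴴ) ?_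
  rw [cayley, Matrix.mul_smul, Matrix.fromBlocks_conjTranspose, Matrix.fromBlocks_multiply,
    ← Matrix.fromBlocks_one, Matrix.fromBlocks_smul]
  simp [smul_smul]
  rw [← two_smul ℂ, smul_smul]
  norm_num

/-- The level moves together with the matrix, so a first-order shift of the eigenvalue becomes a
shift of the perturbation. -/
theorem pencil_add_smul (P Q : Matrix (Fin n ⊕ Fin n) (Fin n ⊕ Fin n) ℝ) (c ν t : ℝ) :
    pencil (P + t • Q) (c + t * ν) = pencil P c + (t : ℂ) • pencil Q ν := by
  ext a b
  simp [pencil]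
  ring

theorem map_ofReal_congr {ι κ : Type*} [Fintype ι] (M : Matrix ι κ ℝ) (P : Matrix ι ι ℝ) :
    (M.map Complex.ofReal)ᴴ * P.map Complex.ofReal * M.map Complex.ofReal
      = (Mᵀ * P * M).map Complex.ofReal := by
  ext a b
  simp [Matrix.mul_apply]

theorem IsSymplectic.pencil_congr {M : Matrix (Fin n ⊕ Fin n) (Fin n ⊕ Fin n) ℝ}
    (hM : IsSymplectic M) (P : Matrix (Fin n ⊕ Fin n) (Fin n ⊕ Fin n) ℝ) (c : ℝ) :
    (M.map Complex.ofReal)ᴴ * pencil P c * M.map Complex.ofReal = pencil (Mᵀ * P * M) c := by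
  rw [pencil, pencil, Matrix.mul_add, Matrix.add_mul, Matrix.mul_smul, Matrix.smul_mul,
    map_ofReal_congr, map_ofReal_congr, hM]

/-- The columns `(1, i)` and `(1, -i)` are eigenvectors of `iJ` for `-1` and `+1`; their squared
length is the factor `2`. -/
theorem cayley_congr_pencil_diagonal (d : Fin n → ℝ) (c : ℝ) :
    (cayley n)ᴴ * pencil (Matrix.fromBlocks (Matrix.diagonal d) 0 0 (Matrix.diagonal d)) c
      * cayley n = Matrix.diagonal (fun k =>
        ((Sum.elim (fun k => 2 * (d k - c)) (fun k => 2 * (d k + c)) k : ℝ) : ℂ)) := by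
  have hp : pencil (Matrix.fromBlocks (Matrix.diagonal d) 0 0 (Matrix.diagonal d)) c =
      Matrix.fromBlocks (Matrix.diagonal fun k => (d k : ℂ)) (((c : ℂ) * Complex.I) • 1)
        (-((c : ℂ) * Complex.I) • 1) (Matrix.diagonal fun k => (d k : ℂ)) := by
    ext a b
    cases a <;> cases b <;>
      simp [pencil, symplJ, Matrix.diagonal_apply, Matrix.one_apply] <;> (try split_ifs) <;> simp
  rw [hp, cayley, Matrix.fromBlocks_conjTranspose, Matrix.fromBlocks_multiply,
    Matrix.fromBlocks_multiply]
  ext a b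
  rcases a with a | a <;> rcases b with b | b <;>
    simp [Matrix.diagonal_apply, Matrix.one_apply] <;> split_ifs <;> (try simp) <;>
    ring_nf <;> (try rw [Complex.I_sq]) <;> ring

/-- The form evaluated on the vectors `u_k + i v_k`: this is where the Hermitian matrix of the
theorem comes from. -/
theorem cayley_congr_pencil_inl {P : Matrix (Fin n ⊕ Fin n) (Fin n ⊕ Fin n) ℝ}
    (hP : P.IsSymm) (ν : ℝ) :
    ((cayley n)ᴴ * pencil P ν * cayley n).toBlocks₁₁
      = complexify P - ((2 * ν : ℝ) : ℂ) • 1 := by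
  have hp : pencil P ν =
      Matrix.fromBlocks (P.toBlocks₁₁.map Complex.ofReal)
        (P.toBlocks₁₂.map Complex.ofReal + ((ν : ℂ) * Complex.I) • 1)
        (P.toBlocks₁₂ᵀ.map Complex.ofReal - ((ν : ℂ) * Complex.I) • 1)
        (P.toBlocks₂₂.map Complex.ofReal) := by
    ext a b
    have h21 : ∀ a b, P (Sum.inr a) (Sum.inl b) = P (Sum.inl b) (Sum.inr a) :=
      fun a b => hP.apply _ _
    cases a <;> cases b <;>
      simp [pencil, symplJ, Matrix.one_apply, Matrix.toBlocks₁₁, Matrix.toBlocks₁₂,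
        Matrix.toBlocks₂₂, h21] <;> split_ifs <;> simp [sub_eq_add_neg]
  rw [hp, cayley, Matrix.fromBlocks_conjTranspose, Matrix.fromBlocks_multiply,
    Matrix.fromBlocks_multiply, Matrix.toBlocks_fromBlocks₁₁]
  ext a b
  simp [complexify, Matrix.one_apply]
  split_ifs <;> ring_nf <;> simp [sub_eq_add_neg]

theorem card_le_card_add_card {f g : Fin n → ℝ} {κ : Type*} [Fintype κ]
    {F G₁ : Matrix (Fin n ⊕ Fin n) (Fin n ⊕ Fin n) ℂ} (hG₁ : IsUnit G₁)
    (h₁ : G₁ᴴ * F * G₁ = Matrix.diagonal (fun k => ((Sum.elim f g k : ℝ) : ℂ)))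
    {G : Matrix (Fin n ⊕ Fin n) κ ℂ} (hG : IsRePos (Gᴴ * F * G)) :
    Fintype.card κ ≤ (Finset.univ.filter fun k => 0 < f k).card +
      (Finset.univ.filter fun k => 0 < g k).card := by
  refine (card_le_card_pos hG₁ h₁ hG).trans_eq ?_
  rw [Fintype.card_congr Equiv.subtypeSum, Fintype.card_sum, Fintype.card_subtype,
    Fintype.card_subtype]

/-- Positivity of the pencil on a subspace of dimension `2n - m` bounds the symplectic
eigenvalue from below. -/
theorem lt_of_isRePos_pencil {P M : Matrix (Fin n ⊕ Fin n) (Fin n ⊕ Fin n) ℝ} {d : Fin n → ℝ}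
    (hd : Monotone d) (hM : IsSymplectic M) (hMu : IsUnit M)
    (hMP : Mᵀ * P * M = Matrix.fromBlocks (Matrix.diagonal d) 0 0 (Matrix.diagonal d))
    {κ : Type*} [Fintype κ] {c : ℝ} {G : Matrix (Fin n ⊕ Fin n) κ ℂ}
    (hG : IsRePos (Gᴴ * pencil P c * G)) {m : Fin n} (hκ : Fintype.card κ = (n - m) + n) :
    c < d m := by
  by_contra hlt
  have hMC : IsUnit (M.map Complex.ofReal) := hMu.map Complex.ofRealHom.mapMatrix
  have h := card_le_card_add_card (hMC.mul (isUnit_cayley n)) (F := pencil P c)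
    (by
      rw [← cayley_congr_pencil_diagonal d c, ← hMP, ← hM.pencil_congr]
      simp only [Matrix.conjTranspose_mul, Matrix.mul_assoc]) hG
  have h1 : (Finset.univ.filter fun k => 0 < 2 * (d k - c)) ⊆ Finset.Ioi m := by
    intro k hk
    rw [Finset.mem_filter] at hk
    rw [Finset.mem_Ioi]
    by_contra hkm
    have := hd (not_lt.1 hkm)
    linarith [hk.2]
  have h2 := Finset.card_le_card h1
  -- The `d + c` entries contribute at most `n`, so at least `n - m` of the `d k - c` would have to
  -- be positive, while only the `n - m - 1` indices beyond `m` are available.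
  have h3 := Finset.card_filter_le (Finset.univ : Finset (Fin n)) fun k => 0 < 2 * (d k + c)
  rw [Fin.card_Ioi] at h2
  rw [Finset.card_univ, Fintype.card_fin] at h3
  have := m.isLt
  omega

/-- Negativity of the pencil on a subspace of dimension `m + 1` bounds the symplectic
eigenvalue from above. -/
theorem lt_of_isRePos_neg_pencil {P M : Matrix (Fin n ⊕ Fin n) (Fin n ⊕ Fin n) ℝ}
    {d : Fin n → ℝ}
    (hd : Monotone d) (hd0 : ∀ k, 0 < d k) (hM : IsSymplectic M) (hMu : IsUnit M)
    (hMP : Mᵀ * P * M = Matrix.fromBlocks (Matrix.diagonal d) 0 0 (Matrix.diagonal d))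
    {κ : Type*} [Fintype κ] {c : ℝ} (hc : 0 < c) {G : Matrix (Fin n ⊕ Fin n) κ ℂ}
    (hG : IsRePos (Gᴴ * -pencil P c * G)) {m : Fin n} (hκ : Fintype.card κ = m + 1) :
    d m < c := by
  by_contra hlt
  have hMC : IsUnit (M.map Complex.ofReal) := hMu.map Complex.ofRealHom.mapMatrix
  have h := card_le_card_add_card (hMC.mul (isUnit_cayley n)) (F := -pencil P c)
    (f := fun k => -(2 * (d k - c))) (g := fun k => -(2 * (d k + c)))
    (by
      have h0 := cayley_congr_pencil_diagonal d c
      rw [← hMP, ← hM.pencil_congr] at h0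
      have h1 := congrArg Neg.neg h0
      rw [Matrix.diagonal_neg] at h1
      refine Eq.trans ?_ (h1.trans ?_)
      · simp only [Matrix.conjTranspose_mul, Matrix.mul_assoc, Matrix.mul_neg, Matrix.neg_mul]
      · congr 1
        ext k
        cases k <;> simp) hG
  have h1 : (Finset.univ.filter fun k => 0 < -(2 * (d k - c))) ⊆ Finset.Iio m := by
    intro k hk
    rw [Finset.mem_filter] at hk
    rw [Finset.mem_Iio]
    by_contra hkm
    have := hd (not_lt.1 hkm)
    linarith [hk.2]
  have h2 := Finset.card_le_card h1
  -- Positivity of `d` and `c` excludes any contribution from the second family.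
  have h3 : (Finset.univ.filter fun k => 0 < -(2 * (d k + c))) = ∅ := by
    rw [Finset.filter_eq_empty_iff]
    intro k _
    linarith [hd0 k]
  rw [h3, Finset.card_empty] at h
  rw [Fin.card_Iio] at h2
  omega

/-! ### Symplectic eigenbases and positivity under small perturbation -/

theorem IsSymplectic.isUnit {M : Matrix (Fin n ⊕ Fin n) (Fin n ⊕ Fin n) ℝ}
    (hM : IsSymplectic M) : IsUnit M := by
  refine IsUnit.of_mul_eq_one_right (-symplJ n * (Mᵀ * symplJ n)) ?_
  rw [Matrix.mul_assoc, hM, Matrix.neg_mul, symplJ_mul_self, neg_neg]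

/-- The normal form factors as `J K = Mᵀ J M K`; cancelling `Mᵀ` leaves `A M = J M K`, whose columns
are the eigenvector equations. -/
theorem IsSymplectic.mem_symplEigenbases_iff {A M : Matrix (Fin n ⊕ Fin n) (Fin n ⊕ Fin n) ℝ}
    (hM : IsSymplectic M) : M ∈ symplEigenbases A ↔ Mᵀ * A * M =
      Matrix.fromBlocks (Matrix.diagonal (symplEig A)) 0 0 (Matrix.diagonal (symplEig A)) := by
  set D := Matrix.diagonal (symplEig A) with hD
  set K : Matrix (Fin n ⊕ Fin n) (Fin n ⊕ Fin n) ℝ := Matrix.fromBlocks 0 (-D) D 0 with hK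
  have hJK : symplJ n * K = Matrix.fromBlocks D 0 0 D := by
    rw [symplJ, hK, Matrix.fromBlocks_multiply]
    simp
  have h1 : Mᵀ * A * M = Matrix.fromBlocks D 0 0 D ↔ A * M = symplJ n * M * K := by
    rw [← hJK]
    conv_lhs => rw [← show Mᵀ * symplJ n * M = symplJ n from hM]
    rw [Matrix.mul_assoc, Matrix.mul_assoc, Matrix.mul_assoc, ← Matrix.mul_assoc (symplJ n)]
    exact ((Matrix.isUnit_transpose M).2 hM.isUnit).mul_right_inj
  rw [h1]
  have hl : ∀ a j, (symplJ n * M * K) a (Sum.inl j) =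
      (symplEig A j • (symplJ n *ᵥ M.col (Sum.inr j))) a := by
    intro a j
    rw [Matrix.mul_apply, Fintype.sum_sum_type]
    simp only [hK, hD, Matrix.fromBlocks_apply₁₁, Matrix.fromBlocks_apply₂₁, Matrix.zero_apply,
      mul_zero, Finset.sum_const_zero, zero_add, Matrix.diagonal_apply, mul_ite,
      Finset.sum_ite_eq', Finset.mem_univ, if_true]
    exact mul_comm _ _
  have hr : ∀ a j, (symplJ n * M * K) a (Sum.inr j) =
      (-(symplEig A j • (symplJ n *ᵥ M.col (Sum.inl j)))) a := by
    intro a j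
    rw [Matrix.mul_apply, Fintype.sum_sum_type]
    simp only [hK, hD, Matrix.fromBlocks_apply₁₂, Matrix.fromBlocks_apply₂₂, Matrix.zero_apply,
      mul_zero, Finset.sum_const_zero, add_zero, Matrix.diagonal_apply, mul_ite, Matrix.neg_apply,
      Finset.sum_ite_eq', Finset.mem_univ, if_true, mul_neg, Finset.sum_neg_distrib]
    exact congrArg Neg.neg (mul_comm _ _)
  constructor
  · rintro ⟨-, h⟩
    ext a (j | j)
    · rw [hl]
      exact congrFun (h j).1 a
    · rw [hr]
      exact congrFun (h j).2 a
  · intro h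
    refine ⟨hM, fun j => ⟨?_, ?_⟩⟩
    · ext a
      rw [← hl, ← h]
      rfl
    · ext a
      rw [← hr, ← h]
      rfl

theorem isWilliamsonDiagonal_symplEig {A : Matrix (Fin n ⊕ Fin n) (Fin n ⊕ Fin n) ℝ}
    (hA : A.PosDef) : IsWilliamsonDiagonal A (symplEig A) := by
  rw [symplEig, dif_pos (exists_isWilliamsonDiagonal hA)]
  exact (exists_isWilliamsonDiagonal hA).choose_spec

theorem symplEigenbases_nonempty {A : Matrix (Fin n ⊕ Fin n) (Fin n ⊕ Fin n) ℝ}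
    (hA : A.PosDef) : (symplEigenbases A).Nonempty := by
  obtain ⟨-, -, M, hM, h⟩ := isWilliamsonDiagonal_symplEig hA
  exact ⟨M, hM.mem_symplEigenbases_iff.2 h⟩

theorem eventually_posDef_add_smul {A B : Matrix (Fin n ⊕ Fin n) (Fin n ⊕ Fin n) ℝ}
    (hA : A.PosDef) (hB : B.IsSymm) : ∀ᶠ t : ℝ in 𝓝[>] 0, (A + t • B).PosDef := by
  obtain ⟨R, hR, hRA⟩ := exists_congr_one hA
  -- With `f = 1` the zero set is empty, so the conditions on `y` are vacuous.
  have h := eventually_isRePos_diagonal_add_smul (𝕜 := ℝ) (f := fun _ : Fin n ⊕ Fin n => 1)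
    (fun _ => zero_le_one) (Y := Rᵀ * B * R) (y := 0) (fun _ h => absurd h one_ne_zero)
    fun _ _ h => absurd h one_ne_zero
  filter_upwards [h] with t ht
  have hRdet := (Matrix.isUnit_iff_isUnit_det R).1 hR
  have hRR : R * R⁻¹ = 1 := Matrix.mul_nonsing_inv _ hRdet
  have h1 := ht.congr (G := R⁻¹) (Matrix.mulVec_injective_iff_isUnit.2
    ((Matrix.isUnit_nonsing_inv_iff).2 hR))
  have h2 : (R⁻¹)ᴴ * (Matrix.diagonal (fun _ : Fin n ⊕ Fin n => ((1 : ℝ) : ℝ)) +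
      t • (Rᵀ * B * R)) * R⁻¹ = A + t • B := by
    rw [Matrix.diagonal_one, ← hRA, Matrix.conjTranspose_eq_transpose_of_trivial,
      ← Matrix.smul_mul, ← Matrix.mul_smul, ← Matrix.add_mul, ← Matrix.mul_add]
    calc _ = (R * R⁻¹)ᵀ * (A + t • B) * (R * R⁻¹) := by
          rw [Matrix.transpose_mul]
          simp only [Matrix.mul_assoc]
      _ = A + t • B := by simp [hRR]
  have h3 : IsRePos (A + t • B) := by
    rw [← h2]
    exact h1
  refine Matrix.PosDef.of_dotProduct_mulVec_pos ?_ fun x hx => h3 x hx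
  rw [Matrix.IsHermitian, Matrix.conjTranspose_eq_transpose_of_trivial, Matrix.transpose_add,
    Matrix.transpose_smul, hB.eq, ← Matrix.conjTranspose_eq_transpose_of_trivial,
    hA.isHermitian.eq]

/-! ### A basis adapted to the eigenvalue `d_m(A)` -/

theorem toBlocks₁₁_congr (U : Matrix (Fin n) (Fin n) ℂ)
    (N : Matrix (Fin n ⊕ Fin n) (Fin n ⊕ Fin n) ℂ) :
    ((Matrix.fromBlocks U 0 0 1)ᴴ * N * (Matrix.fromBlocks U 0 0 1 : Matrix _ _ ℂ)).toBlocks₁₁ =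
      Uᴴ * N.toBlocks₁₁ * U := by
  conv_lhs => rw [← Matrix.fromBlocks_toBlocks N]
  rw [Matrix.fromBlocks_conjTranspose, Matrix.fromBlocks_multiply, Matrix.fromBlocks_multiply,
    Matrix.toBlocks_fromBlocks₁₁]
  simp

/-- A basis in which the pencil of `A` is diagonal, and in which the compression of the pencil of
`B` to the eigenspace of `d_m(A)` is diagonal with increasing entries. -/
theorem exists_adapted_basis {A M B : Matrix (Fin n ⊕ Fin n) (Fin n ⊕ Fin n) ℝ}
    (hd : Monotone (symplEig A)) (hM : M ∈ symplEigenbases A) (hB : B.IsSymm) (m : Fin n) :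
    ∃ (G : Matrix (Fin n ⊕ Fin n) (Fin n ⊕ Fin n) ℂ) (b : Fin n → ℝ),
      (∀ c : ℝ, Gᴴ * pencil A c * G = Matrix.diagonal (fun k =>
        ((Sum.elim (fun k => 2 * (symplEig A k - c)) (fun k => 2 * (symplEig A k + c)) k : ℝ)
          : ℂ))) ∧
      (∀ (ν : ℝ) (k l : Fin n), symplEig A k = symplEig A m → symplEig A l = symplEig A m →
        (Gᴴ * pencil B ν * G) (Sum.inl k) (Sum.inl l) =
          if k = l then ((b k - 2 * ν : ℝ) : ℂ) else 0) ∧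
      (∀ k l, symplEig A k = symplEig A m → symplEig A l = symplEig A m → k ≤ l → b k ≤ b l) ∧
      b m = -lamDown (isHermitian_complexify (isSymm_tildeB A M m hB)) (iIdx A m)
              (one_le_iIdx A m) (Nat.le_add_right (iIdx A m) (jIdx A m)) := by
  have hMs : IsSymplectic M := hM.1
  have hMA := hMs.mem_symplEigenbases_iff.1 hM
  have hH := isHermitian_complexify (isSymm_tildeB A M m hB)
  have hblk := block_le A m
  have hile := iIdx_le A m
  have hi1 := one_le_iIdx A m
  have hr : rIdx A m = iIdx A m + jIdx A m := rfl
  set d := symplEig A with hddef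
  set r := rIdx A m with hrdef
  -- The 0-based first index of the block of indices `k` with `d k = d m`.
  set a := (m : ℕ) + 1 - iIdx A m with ha
  set c : Fin r → Fin n := fun k => ⟨a + k, by have := k.isLt; omega⟩ with hc
  have hcinj : Function.Injective c := by
    intro k l h
    have := congrArg Fin.val h
    simp only [hc] at this
    exact Fin.ext (by omega)
  have hmem : ∀ k, d k = d m ↔ a ≤ k ∧ (k : ℕ) < a + r := by
    intro k
    have := eq_iff_of_monotone hd m k (i := iIdx A m) (j := jIdx A m) rfl rfl
    rw [this]
    omega
  have hdc : ∀ k, d (c k) = d m := by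
    intro k
    rw [hmem]
    have := k.isLt
    simp only [hc]
    omega
  have hcsurj : ∀ k, d k = d m → ∃ k', c k' = k := by
    intro k hk
    rw [hmem] at hk
    exact ⟨⟨k - a, by omega⟩, Fin.ext (by simp only [hc]; omega)⟩
  obtain ⟨W, hW1, hW2⟩ := exists_unitary_diagonal_eigenvalues₀ hH
  obtain ⟨U, hU1, hU2⟩ := exists_unitary_extension hcinj hW1
  set ev : Fin r → ℝ := fun k => hH.eigenvalues₀ (Fin.cast (Fintype.card_fin r).symm k) with hev
  have hevanti : Antitone ev := fun k l hkl => hH.eigenvalues₀_antitone hkl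
  -- The minus sign in `tildeB` turns the decreasing eigenvalues into increasing `b`. The value `0`
  -- off the block plays no role in the claims.
  set b : Fin n → ℝ := fun k =>
    if h : a ≤ k ∧ (k : ℕ) < a + r then -ev ⟨k - a, by omega⟩ else 0 with hb
  have hbc : ∀ k, b (c k) = -ev k := by
    intro k
    have h : a ≤ (c k : ℕ) ∧ (c k : ℕ) < a + r := (hmem _).1 (hdc k)
    simp only [hb, dif_pos h]
    congr 2
    exact Fin.ext (by simp [hc])
  have hG : ∀ P c, (M.map Complex.ofReal * cayley n * Matrix.fromBlocks U 0 0 1)ᴴ * pencil P c *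
      (M.map Complex.ofReal * cayley n * Matrix.fromBlocks U 0 0 1) =
      (Matrix.fromBlocks U 0 0 1)ᴴ * ((cayley n)ᴴ * pencil (Mᵀ * P * M) c * cayley n) *
        Matrix.fromBlocks U 0 0 1 := by
    intro P c
    rw [← hMs.pencil_congr]
    simp only [Matrix.conjTranspose_mul, Matrix.mul_assoc]
  -- `U` only rotates the vectors `u_k + i v_k` inside the block, where the pencil of `A` is scalar,
  -- so its diagonal form survives while that of `B` is diagonalized.
  refine ⟨M.map Complex.ofReal * cayley n * Matrix.fromBlocks U 0 0 1, b, fun x => ?_,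
    fun ν k l hk hl => ?_, fun k l hk hl hkl => ?_, ?_⟩
  · rw [hG, hMA, cayley_congr_pencil_diagonal]
    have : (fun k => ((Sum.elim (fun k => 2 * (d k - x)) (fun k => 2 * (d k + x)) k : ℝ) : ℂ)) =
        Sum.elim (fun k => ((2 * (d k - x) : ℝ) : ℂ)) (fun k => ((2 * (d k + x) : ℝ) : ℂ)) := by
      ext k
      cases k <;> rfl
    rw [this, ← Matrix.fromBlocks_diagonal, Matrix.fromBlocks_conjTranspose,
      Matrix.fromBlocks_multiply, Matrix.fromBlocks_multiply]
    simp only [Matrix.conjTranspose_zero, Matrix.conjTranspose_one, Matrix.mul_zero,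
      Matrix.zero_mul, Matrix.mul_one, Matrix.one_mul, add_zero, zero_add]
    rw [hU1 _ fun k l => by rw [hdc, hdc]]
  · obtain ⟨k, rfl⟩ := hcsurj k hk
    obtain ⟨l, rfl⟩ := hcsurj l hl
    have hsymm : (Mᵀ * B * M).IsSymm := by
      rw [Matrix.IsSymm, Matrix.transpose_mul, Matrix.transpose_mul, Matrix.transpose_transpose,
        hB.eq, Matrix.mul_assoc]
    have hXc : (complexify (Mᵀ * B * M)).submatrix c c = -complexify (tildeB A M m B) := by
      have : ∀ p q, tildeB A M m B p q = -(Mᵀ * B * M) (Sum.map c c p) (Sum.map c c q) :=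
        fun p q => rfl
      ext p q
      simp only [complexify, Matrix.submatrix_apply, Matrix.add_apply, Matrix.neg_apply,
        Matrix.map_apply, Matrix.smul_apply, Matrix.sub_apply, Matrix.transpose_apply,
        Matrix.toBlocks₁₁, Matrix.toBlocks₂₂, Matrix.toBlocks₁₂, Matrix.of_apply, this,
        Sum.map_inl, Sum.map_inr]
      push_cast
      simp only [smul_eq_mul]
      ring
    have h11 := congrFun (congrFun (toBlocks₁₁_congr U
      ((cayley n)ᴴ * pencil (Mᵀ * B * M) ν * cayley n)) (c k)) (c l)
    rw [hG]
    refine h11.trans ?_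
    rw [cayley_congr_pencil_inl hsymm, hU2, Matrix.submatrix_sub]
    simp only [Pi.sub_apply]
    have hone : ((((2 * ν : ℝ) : ℂ) • (1 : Matrix (Fin n) (Fin n) ℂ))).submatrix c c =
        ((2 * ν : ℝ) : ℂ) • 1 := by
      rw [Matrix.submatrix_smul]
      simp only [Pi.smul_apply]
      rw [Matrix.submatrix_one _ hcinj]
    rw [hone, hXc, Matrix.mul_sub, Matrix.sub_mul, Matrix.mul_neg, Matrix.neg_mul, hW2,
      Matrix.mul_smul, Matrix.smul_mul, Matrix.mul_one, hW1]
    simp only [Matrix.sub_apply, Matrix.neg_apply, Matrix.smul_apply, Matrix.diagonal_apply,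
      Matrix.one_apply, hcinj.eq_iff, hbc]
    split_ifs
    · simp [hev]
    · simp
  · obtain ⟨k, rfl⟩ := hcsurj k hk
    obtain ⟨l, rfl⟩ := hcsurj l hl
    rw [hbc, hbc]
    refine neg_le_neg (hevanti ?_)
    have : (c k : ℕ) ≤ c l := hkl
    simp only [hc] at this
    exact Fin.le_def.2 (by omega)
  -- The offset of `m` in its block is `m - a = i_m - 1`, the 0-based index used by `lamDown`.
  · have hm : a ≤ (m : ℕ) ∧ (m : ℕ) < a + r := by omega
    simp only [hb, dif_pos hm, hev, lamDown]
    congr 2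
    exact Fin.ext (by simp; omega)

/-! ### First-order bounds and the directional derivative -/

theorem submatrix_congr {ι κ : Type*} [Fintype ι] (G F : Matrix ι ι ℂ) (e : κ → ι) :
    (G.submatrix id e)ᴴ * F * G.submatrix id e = (Gᴴ * F * G).submatrix e e := rfl

/-- If, in a basis in which the pencil of `A` is diagonal, the compression of the pencil of `B`
to the eigenspace of `d m` is diagonal with entries `b`, then `d m + t (b m / 2 + ε)` is an upper
bound for the `m`-th symplectic eigenvalue of `A + t B`. -/
theorem eventually_lt_add {A B : Matrix (Fin n ⊕ Fin n) (Fin n ⊕ Fin n) ℝ} {d b : Fin n → ℝ}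
    (hd : Monotone d) {m : Fin n} (hm : 0 < d m) {G : Matrix (Fin n ⊕ Fin n) (Fin n ⊕ Fin n) ℂ}
    (hGA : ∀ c : ℝ, Gᴴ * pencil A c * G = Matrix.diagonal (fun k =>
        ((Sum.elim (fun k => 2 * (d k - c)) (fun k => 2 * (d k + c)) k : ℝ) : ℂ)))
    (hGB : ∀ (ν : ℝ) (k l : Fin n), d k = d m → d l = d m →
        (Gᴴ * pencil B ν * G) (Sum.inl k) (Sum.inl l) =
          if k = l then ((b k - 2 * ν : ℝ) : ℂ) else 0)
    (hb : ∀ k l, d k = d m → d l = d m → k ≤ l → b k ≤ b l) {ε : ℝ} (hε : 0 < ε) :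
    ∀ᶠ t : ℝ in 𝓝[>] 0, ∀ d', IsWilliamsonDiagonal (A + t • B) d' →
      d' m < d m + t * (b m / 2 + ε) := by
  -- For `k ≤ m` in the block, `2ν - b k = (b m - b k) + 2ε > 0`, so minus the pencil is positive on
  -- these `m + 1` directions.
  set ν := b m / 2 + ε with hν
  set e : {k : Fin n // k ≤ m} → Fin n ⊕ Fin n := fun k => Sum.inl k.1 with he
  have hz : ∀ k : {k : Fin n // k ≤ m}, -(2 * (d k - d m)) = 0 → d k = d m := fun k h => by
    linarith
  have h1 := eventually_isRePos_diagonal_add_smul (𝕜 := ℂ)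
    (f := fun k : {k : Fin n // k ≤ m} => -(2 * (d k - d m)))
    (fun k => by have := hd k.2; linarith)
    (Y := -(Gᴴ * pencil B ν * G).submatrix e e) (y := fun k => -(b k - 2 * ν))
    (fun k hk => by have := hb k m (hz k hk) rfl k.2; rw [hν]; linarith)
    (fun k l hk hl => by
      rw [Matrix.neg_apply, Matrix.submatrix_apply, hGB ν _ _ (hz k hk) (hz l hl)]
      simp only [Subtype.ext_iff]
      split_ifs <;> simp)
  have h2 : ∀ᶠ t : ℝ in 𝓝[>] 0, 0 < d m + t * ν := by
    have : Tendsto (fun t : ℝ => d m + t * ν) (𝓝 0) (𝓝 (d m + 0 * ν)) :=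
      (by fun_prop : Continuous fun t : ℝ => d m + t * ν).tendsto 0
    exact (this.mono_left nhdsWithin_le_nhds).eventually_const_lt (by simpa using hm)
  filter_upwards [h1, h2] with t ht htc d' ⟨hd', hd0', M, hM, hMA⟩
  refine lt_of_isRePos_neg_pencil hd' hd0' hM hM.isUnit hMA htc (G := G.submatrix id e) ?_ ?_
  · rw [submatrix_congr, pencil_add_smul, Matrix.mul_neg, Matrix.neg_mul, Matrix.mul_add,
      Matrix.add_mul, hGA, Matrix.mul_smul, Matrix.smul_mul]
    convert ht using 1
    ext k l
    simp [he, Matrix.diagonal_apply, Subtype.ext_iff]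
    split_ifs <;> try simp
    ring
  · rw [Fintype.card_subtype, ← Fin.card_Iic]
    congr 1
    ext
    simp

/-- The lower bound matching `eventually_lt_add`. -/
theorem eventually_sub_lt {A B : Matrix (Fin n ⊕ Fin n) (Fin n ⊕ Fin n) ℝ} {d b : Fin n → ℝ}
    (hd : Monotone d) (hd0 : ∀ k, 0 < d k) {m : Fin n}
    {G : Matrix (Fin n ⊕ Fin n) (Fin n ⊕ Fin n) ℂ}
    (hGA : ∀ c : ℝ, Gᴴ * pencil A c * G = Matrix.diagonal (fun k =>
        ((Sum.elim (fun k => 2 * (d k - c)) (fun k => 2 * (d k + c)) k : ℝ) : ℂ)))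
    (hGB : ∀ (ν : ℝ) (k l : Fin n), d k = d m → d l = d m →
        (Gᴴ * pencil B ν * G) (Sum.inl k) (Sum.inl l) =
          if k = l then ((b k - 2 * ν : ℝ) : ℂ) else 0)
    (hb : ∀ k l, d k = d m → d l = d m → k ≤ l → b k ≤ b l) {ε : ℝ} (hε : 0 < ε) :
    ∀ᶠ t : ℝ in 𝓝[>] 0, ∀ d', IsWilliamsonDiagonal (A + t • B) d' →
      d m + t * (b m / 2 - ε) < d' m := by
  set ν := b m / 2 - ε with hν
  -- Indices from `m` on, together with the whole second family: `(n - m) + n` directions. The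
  -- entries `2 (d k + d m)` are positive, so the kernel lies in the first summand, where `b k - 2ν
  -- ≥ 2ε`.
  set e : {k : Fin n // m ≤ k} ⊕ Fin n → Fin n ⊕ Fin n := Sum.map Subtype.val id with he
  have heinj : Function.Injective e := Sum.map_injective.2 ⟨Subtype.val_injective, fun _ _ h => h⟩
  have h1 := eventually_isRePos_diagonal_add_smul (𝕜 := ℂ)
    (f := Sum.elim (fun k : {k : Fin n // m ≤ k} => 2 * (d k - d m)) fun k => 2 * (d k + d m))
    (by
      rintro (k | k)
      · have := hd k.2
        simp only [Sum.elim_inl]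
        linarith
      · have := hd0 k
        have := hd0 m
        simp only [Sum.elim_inr]
        linarith)
    (Y := (Gᴴ * pencil B ν * G).submatrix e e) (y := Sum.elim (fun k => b k - 2 * ν) 1)
    (by
      rintro (k | k) hk
      · have hkm : d k = d m := by simp only [Sum.elim_inl] at hk; linarith
        have := hb m k rfl hkm k.2
        simp only [Sum.elim_inl, hν]
        linarith
      · exact zero_lt_one)
    (by
      have hr : ∀ k, 2 * (d k + d m) ≠ 0 := fun k => by
        have := hd0 k
        have := hd0 m
        positivity
      rintro (k | k) (l | l) hk hl
      · simp only [Sum.elim_inl] at hk hl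
        rw [Matrix.submatrix_apply]
        simp only [he, Sum.map_inl, Sum.inl.injEq, Sum.elim_inl, Subtype.ext_iff]
        exact hGB ν _ _ (by linarith) (by linarith)
      · exact absurd hl (hr l)
      · exact absurd hk (hr k)
      · exact absurd hk (hr k))
  filter_upwards [h1] with t ht d' ⟨hd', hd0', M, hM, hMA⟩
  refine lt_of_isRePos_pencil hd' hM hM.isUnit hMA (G := G.submatrix id e) ?_ ?_
  · rw [submatrix_congr, pencil_add_smul, Matrix.mul_add, Matrix.add_mul, hGA, Matrix.mul_smul,
      Matrix.smul_mul]
    convert ht using 1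
    rw [Matrix.submatrix_add, Matrix.submatrix_smul]
    simp only [Pi.add_apply, Pi.smul_apply]
    rw [Matrix.submatrix_diagonal _ _ heinj]
    congr 2
    ext k
    cases k <;> rfl
  · rw [Fintype.card_sum, Fintype.card_fin, Fintype.card_subtype, ← Fin.card_Ici]
    congr 2
    ext
    simp

/-- The bounds hold for every Williamson diagonal of `A + tB`, so the one chosen by `symplEig` obeys
them once `A + tB` is positive definite; uniqueness of the normal form is not needed. -/
theorem hasDirDerivAt_symplEig {A : Matrix (Fin n ⊕ Fin n) (Fin n ⊕ Fin n) ℝ} (hA : A.PosDef)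
    (m : Fin n) {M B : Matrix (Fin n ⊕ Fin n) (Fin n ⊕ Fin n) ℝ} (hM : M ∈ symplEigenbases A)
    (hB : B.IsSymm) :
    HasDirDerivAt (fun P => symplEig P m) A B
      (-(1 / 2 : ℝ) *
        lamDown (isHermitian_complexify (isSymm_tildeB A M m hB)) (iIdx A m)
          (one_le_iIdx A m) (Nat.le_add_right (iIdx A m) (jIdx A m))) := by
  obtain ⟨hd, hd0, -⟩ := isWilliamsonDiagonal_symplEig hA
  obtain ⟨G, b, hGA, hGB, hb, hbm⟩ := exists_adapted_basis hd hM hB m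
  have hlim : -(1 / 2 : ℝ) *
        lamDown (isHermitian_complexify (isSymm_tildeB A M m hB)) (iIdx A m)
          (one_le_iIdx A m) (Nat.le_add_right (iIdx A m) (jIdx A m)) = b m / 2 := by
    rw [hbm]
    ring
  rw [hlim, HasDirDerivAt, Metric.tendsto_nhds]
  intro ε hε
  filter_upwards [eventually_lt_add hd (hd0 m) hGA hGB hb hε,
    eventually_sub_lt hd hd0 hGA hGB hb hε, eventually_posDef_add_smul hA hB,
    self_mem_nhdsWithin] with t h1 h2 h3 h4
  have ht : 0 < t := h4
  have hw := isWilliamsonDiagonal_symplEig h3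
  have h1 := h1 _ hw
  have h2 := h2 _ hw
  rw [Real.dist_eq, abs_lt, lt_sub_iff_add_lt, sub_lt_iff_lt_add, lt_div_iff₀ ht, div_lt_iff₀ ht]
  constructor <;> linarith

end SymplecticEigenvalues

end

open SymplecticEigenvalues in
theorem mainTheorem1 (n : ℕ) (A : Matrix (Fin n ⊕ Fin n) (Fin n ⊕ Fin n) ℝ) (hA : A.PosDef)
    (m : Fin n) :
    DirDifferentiableAt (fun P => symplEig P m) A ∧
    ∀ M ∈ symplEigenbases A,
      ∀ (B : Matrix (Fin n ⊕ Fin n) (Fin n ⊕ Fin n) ℝ) (hB : B.IsSymm),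
        HasDirDerivAt (fun P => symplEig P m) A B
          (-(1 / 2 : ℝ) *
            lamDown (isHermitian_complexify (isSymm_tildeB A M m hB)) (iIdx A m)
              (one_le_iIdx A m) (Nat.le_add_right (iIdx A m) (jIdx A m))) := by
  obtain ⟨M, hM⟩ := symplEigenbases_nonempty hA
  exact ⟨fun B hB => ⟨_, hasDirDerivAt_symplEig hA m hM hB⟩,
    fun M hM B hB => hasDirDerivAt_symplEig hA m hM hB⟩
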